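/- Let $M$ be a connected (Hausdorff, finite-dimensional, boundaryless) smooth manifold. A (conic) pseudo-Finsler structure on $M$ is a pair $(\mathcal T,F)$, where $\mathcal T$ is an open subset of the tangent bundle $TM$ with its zero section removed and $F:\mathcal T\to(0,+\infty)$ is a $C^\infty$ function, such that: 1. for every $p\in M$, $\mathcal T_p=\mathcal T\cap T_pM$ is a non-empty open cone of $T_pM$ (i.e. $tv\in\mathcal T_p$ for all $v\in\mathcal T_p$ and $t>0$); 2. $F(tv)=tF(v)$ for all $v\in\mathcal T$ and $t>0$; 3. for every $p\in M$ and $v\in\mathcal T_p$, the second derivative at $v$ of the restriction of $F^2$ to $\mathcal T_p$ is a nondegenerate bilinear form on $T_pM$. An isometry of $(M,\mathcal T,F)$ is a diffeomorphism $f:M\to M$ of class $C^2$ (that is, $f$ is bijective and $f$ and $f^{-1}$ are of class $C^2$) with $\mathrm df(\mathcal T)=\mathcal T$ and $F\circ\mathrm df=F$ on $\mathcal T$. Then every isometry of $(M,\mathcal T,F)$ is a $C^\infty$ map, and it is completely determined by its second jet at any single point: if $f$ and $g$ are isometries of $(M,\mathcal T,F)$ that have the same second jet at some point $p\in M$ (i.e.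 $f(p)=g(p)$ and, in local charts, $f$ and $g$ have the same derivatives of order at most $2$ at $p$), then $f=g$ on $M$. -/

import Mathlib

open scoped Manifold ContDiff

/-- A (conic) pseudo-Finsler structure `(M, 𝒯, F)` on a smooth manifold `M` modelled on `E`.
The function `F` is written as a total function on the tangent bundle, but only its values on the
open set `𝒯 = cone` are constrained or ever used. -/
structure PseudoFinslerStructure
    (E : Type*) [NormedAddCommGroup E] [NormedSpace ℝ E]
    (M : Type*) [TopologicalSpace M] [ChartedSpace E M] [IsManifold 𝓘(ℝ, E) ∞ M] where
  /-- The set `𝒯` of admissible vectors. -/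
  cone : Set (TangentBundle 𝓘(ℝ, E) M)
  /-- The pseudo-Finsler metric `F`. -/
  F : TangentBundle 𝓘(ℝ, E) M → ℝ
  isOpen_cone : IsOpen cone
  /-- `𝒯` is contained in the tangent bundle with its zero section removed. -/
  ne_zero_of_mem : ∀ (p : M) (v : TangentSpace 𝓘(ℝ, E) p),
    (⟨p, v⟩ : TangentBundle 𝓘(ℝ, E) M) ∈ cone → v ≠ 0
  /-- Each `𝒯_p = 𝒯 ∩ T_pM` is nonempty. -/
  nonempty_fiber : ∀ p : M, ∃ v : TangentSpace 𝓘(ℝ, E) p,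
    (⟨p, v⟩ : TangentBundle 𝓘(ℝ, E) M) ∈ cone
  /-- Each `𝒯_p` is a cone. -/
  smul_mem : ∀ (p : M) (v : TangentSpace 𝓘(ℝ, E) p) (t : ℝ), 0 < t →
    (⟨p, v⟩ : TangentBundle 𝓘(ℝ, E) M) ∈ cone →
    (⟨p, t • v⟩ : TangentBundle 𝓘(ℝ, E) M) ∈ cone
  /-- `F` is smooth on `𝒯`. -/
  contMDiffOn_F : ContMDiffOn 𝓘(ℝ, E).tangent 𝓘(ℝ, ℝ) ∞ F cone
  /-- `F` takes positive values on `𝒯`. -/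
  F_pos : ∀ v ∈ cone, 0 < F v
  /-- `F` is positively homogeneous of degree one. -/
  F_smul : ∀ (p : M) (v : TangentSpace 𝓘(ℝ, E) p) (t : ℝ), 0 < t →
    (⟨p, v⟩ : TangentBundle 𝓘(ℝ, E) M) ∈ cone →
    F ⟨p, t • v⟩ = t * F ⟨p, v⟩
  /-- The fundamental tensor `g_v`, i.e. the second derivative at `v` of `F ^ 2` restricted to the
  tangent space `T_pM` (whose underlying vector space is `E`), is nondegenerate for `v ∈ 𝒯`. -/
  nondegenerate : ∀ (p : M) (v : E), (⟨p, v⟩ : TangentBundle 𝓘(ℝ, E) M) ∈ cone →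
    ∀ u : E,
      (∀ w : E,
        fderiv ℝ (fderiv ℝ fun y : E => F (⟨p, y⟩ : TangentBundle 𝓘(ℝ, E) M) ^ 2) v u w = 0) →
      u = 0

/-- An isometry (automorphism) of a pseudo-Finsler structure `(M, 𝒯, F)`: a diffeomorphism `f` of
`M` of class `C^2` with `df(𝒯) = 𝒯` and `F ∘ df = F` on `𝒯`. -/
structure PseudoFinslerStructure.IsIsometry
    {E : Type*} [NormedAddCommGroup E] [NormedSpace ℝ E]
    {M : Type*} [TopologicalSpace M] [ChartedSpace E M] [IsManifold 𝓘(ℝ, E) ∞ M]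
    (Φ : PseudoFinslerStructure E M) (f : Diffeomorph 𝓘(ℝ, E) 𝓘(ℝ, E) M M 2) : Prop where
  image_cone : tangentMap 𝓘(ℝ, E) 𝓘(ℝ, E) f '' Φ.cone = Φ.cone
  F_tangentMap : ∀ v ∈ Φ.cone, Φ.F (tangentMap 𝓘(ℝ, E) 𝓘(ℝ, E) f v) = Φ.F v

/-- The maps `f` and `g` (assumed of class `C^k`) have the same `k`-jet at `p`: they agree at `p`,
and their expressions in one chart around `p` and one chart around the common value have the same
derivatives up to order `k` at the point corresponding to `p`. -/
def SameJetAt (E : Type*) [NormedAddCommGroup E] [NormedSpace ℝ E]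
    {M : Type*} [TopologicalSpace M] [ChartedSpace E M]
    (k : ℕ) (f g : M → M) (p : M) : Prop :=
  f p = g p ∧ ∀ j ≤ k,
    iteratedFDeriv ℝ j (extChartAt 𝓘(ℝ, E) (f p) ∘ f ∘ (extChartAt 𝓘(ℝ, E) p).symm)
        (extChartAt 𝓘(ℝ, E) p p) =
      iteratedFDeriv ℝ j (extChartAt 𝓘(ℝ, E) (f p) ∘ g ∘ (extChartAt 𝓘(ℝ, E) p).symm)
        (extChartAt 𝓘(ℝ, E) p p)

/-!
An isometry `f` satisfies, in charts, a second order differential equation that is smooth and solved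
for the second derivatives; both claims follow from it.

In charts, `L = F ^ 2` is a Lagrangian on an open set `Ω` of pairs `(x, v)` whose Hessian in `v` is
nondegenerate, so the Euler–Lagrange equation can be solved for the acceleration:
`x'' = S(x, x')`, where the spray `S` is smooth on `Ω`
(`IsRegularLagrangian.contDiffAt_spray`). Differentiating `L'(f x, f'(x) v) = L(x, v)` once in `x`,
and once in `v` and then along `(v, S(x, v))`, and subtracting, the symmetry of `f''(x)` cancels
the terms containing the vertical derivative of `L'`, and the Euler–Lagrange equation for `L` turns
into the one for `L'`. This gives
`f''(x)(v, v) = S'(f x, f'(x) v) - f'(x) S(x, v)` for `(x, v) ∈ Ω`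
(`IsLagrangianMap.fderiv_fderiv_apply_self`). Geodesics are not needed, and `C^2` regularity of `f`
is enough.

The vectors `v` allowed at `x` form a nonempty open set, so polarization over this set expresses all
of `f''(x)` as a smooth function `Ψ(x, f x, f'(x))` (`exists_contDiffAt_fderiv_fderiv_eq`).
* Smoothness: if `f` and `f'` are `C^n`, then so is `f''`, and induction on `n` applies
  (`IsLagrangianMap.contDiffOn_infty`).
* Rigidity: `Ψ` is locally Lipschitz, so for two isometries `f`, `g` the difference of the 1-jets
  has a derivative bounded by a multiple of its own norm, and Grönwall's inequality makes it vanish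
  near any of its zeros (`IsLagrangianMap.eventuallyEq_of_jet_eq`). Hence the set of points near
  which `f = g` is open and closed, and equality of 1-jets at a single point already suffices
  (`PseudoFinslerStructure.IsIsometry.eq_of_eventuallyEq`).
-/

open Set Filter Topology

/-! ### The spray of a regular Lagrangian -/

section LocalTheory

variable {E : Type*} [NormedAddCommGroup E] [NormedSpace ℝ E]

/-- A regular Lagrangian on an open set `Ω` of pairs (position, velocity): a smooth function whose
Hessian in the velocity variable is nondegenerate. -/
structure IsRegularLagrangian (Ω : Set (E × E)) (L : E × E → ℝ) : Prop where
  isOpen : IsOpen Ω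
  contDiffOn : ContDiffOn ℝ ∞ L Ω
  nondegenerate : ∀ z ∈ Ω, ∀ u : E,
    (∀ w : E, fderiv ℝ (fderiv ℝ L) z (0, u) (0, w) = 0) → u = 0

/-- `f` is `C^2` on the open set `U`, with surjective derivatives, and its tangent map
`(x, v) ↦ (f x, f'(x) v)` sends `Ω` into `Ω'` and pulls the Lagrangian `L'` back to `L` over `U`. -/
structure IsLagrangianMap (Ω : Set (E × E)) (L : E × E → ℝ) (Ω' : Set (E × E)) (L' : E × E → ℝ)
    (U : Set E) (f : E → E) : Prop where
  isOpen : IsOpen U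
  contDiffOn : ContDiffOn ℝ 2 f U
  surjective : ∀ x ∈ U, Function.Surjective (fderiv ℝ f x)
  mem : ∀ x ∈ U, ∀ v, (x, v) ∈ Ω → (f x, fderiv ℝ f x v) ∈ Ω'
  eq : ∀ x ∈ U, ∀ v, (x, v) ∈ Ω → L' (f x, fderiv ℝ f x v) = L (x, v)

/-- The Hessian of a Lagrangian in the velocity variable, as a map from `E` to its dual. -/
noncomputable def vertHessian (L : E × E → ℝ) (z : E × E) : E →L[ℝ] (E →L[ℝ] ℝ) :=
  ((ContinuousLinearMap.compL ℝ E (E × E) ℝ).flip (.inr ℝ E E)).comp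
    ((fderiv ℝ (fderiv ℝ L) z).comp (.inr ℝ E E))

/-- The covector `∂L/∂x - (∂²L/∂x∂v) v`, which the velocity Hessian turns into the acceleration of
a solution of the Euler–Lagrange equation. -/
noncomputable def lagrangianForce (L : E × E → ℝ) (z : E × E) : E →L[ℝ] ℝ :=
  (fderiv ℝ L z).comp (.inl ℝ E E) -
    (fderiv ℝ (fderiv ℝ L) z (ContinuousLinearMap.inl ℝ E E z.2)).comp (.inr ℝ E E)

/-- The spray of a Lagrangian: the Euler–Lagrange equation reads `x'' = spray L (x, x')`. It is the
junk value `0` where the velocity Hessian is not invertible. -/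
noncomputable def spray (L : E × E → ℝ) (z : E × E) : E :=
  (vertHessian L z).inverse (lagrangianForce L z)

lemma vertHessian_apply (L : E × E → ℝ) (z : E × E) (u w : E) :
    vertHessian L z u w = fderiv ℝ (fderiv ℝ L) z (0, u) (0, w) := by
  simp [vertHessian]

lemma lagrangianForce_apply (L : E × E → ℝ) (z : E × E) (w : E) :
    lagrangianForce L z w = fderiv ℝ L z (w, 0) - fderiv ℝ (fderiv ℝ L) z (z.2, 0) (0, w) := by
  simp [lagrangianForce]

variable {Ω Ω' : Set (E × E)} {L L' : E × E → ℝ}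

namespace IsRegularLagrangian

lemma contDiffAt (h : IsRegularLagrangian Ω L) {z : E × E} (hz : z ∈ Ω) : ContDiffAt ℝ ∞ L z :=
  h.contDiffOn.contDiffAt (h.isOpen.mem_nhds hz)

lemma contDiffAt_fderiv (h : IsRegularLagrangian Ω L) {z : E × E} (hz : z ∈ Ω) :
    ContDiffAt ℝ ∞ (fderiv ℝ L) z :=
  (h.contDiffAt hz).fderiv_right (by simp)

lemma contDiffAt_fderiv_fderiv (h : IsRegularLagrangian Ω L) {z : E × E} (hz : z ∈ Ω) :
    ContDiffAt ℝ ∞ (fderiv ℝ (fderiv ℝ L)) z :=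
  (h.contDiffAt_fderiv hz).fderiv_right (by simp)

variable [FiniteDimensional ℝ E]

lemma exists_equiv (h : IsRegularLagrangian Ω L) {z : E × E} (hz : z ∈ Ω) :
    ∃ e : E ≃L[ℝ] (E →L[ℝ] ℝ), (e : E →L[ℝ] (E →L[ℝ] ℝ)) = vertHessian L z := by
  have hinj : Function.Injective (vertHessian L z) := by
    rw [injective_iff_map_eq_zero]
    intro u hu
    refine h.nondegenerate z hz u fun w => ?_
    rw [← vertHessian_apply, hu, zero_apply]
  have hrank : Module.finrank ℝ E = Module.finrank ℝ (E →L[ℝ] ℝ) := by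
    rw [← (LinearMap.toContinuousLinearMap (𝕜 := ℝ) (E := E) (F' := ℝ)).finrank_eq]
    exact (Subspace.dual_finrank_eq (K := ℝ) (V := E)).symm
  refine ⟨(LinearEquiv.ofInjectiveOfFinrankEq (vertHessian L z : E →ₗ[ℝ] (E →L[ℝ] ℝ))
    hinj hrank).toContinuousLinearEquiv, ?_⟩
  ext u w
  rfl

lemma contDiffAt_spray (h : IsRegularLagrangian Ω L) {z : E × E} (hz : z ∈ Ω) :
    ContDiffAt ℝ ∞ (spray L) z := by
  have h1 := h.contDiffAt_fderiv hz
  have h2 := h.contDiffAt_fderiv_fderiv hz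
  have hV : ContDiffAt ℝ ∞ (vertHessian L) z :=
    contDiffAt_const.clm_comp (h2.clm_comp contDiffAt_const)
  have hF : ContDiffAt ℝ ∞ (lagrangianForce L) z := by
    refine (h1.clm_comp contDiffAt_const).sub (ContDiffAt.clm_comp (h2.clm_apply ?_)
      contDiffAt_const)
    exact ((ContinuousLinearMap.inl ℝ E E).contDiff.comp contDiff_snd).contDiffAt
  obtain ⟨e, he⟩ := h.exists_equiv hz
  have hinv := contDiffAt_map_inverse (n := ∞) e
  rw [he] at hinv
  exact (hinv.comp z hV).clm_apply hF

/-- The spray is characterized by the Euler–Lagrange equation. -/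
lemma spray_eq_iff (h : IsRegularLagrangian Ω L) {z : E × E} (hz : z ∈ Ω) (a : E) :
    spray L z = a ↔ ∀ w, fderiv ℝ (fderiv ℝ L) z (z.2, a) (0, w) = fderiv ℝ L z (w, 0) := by
  obtain ⟨e, he⟩ := h.exists_equiv hz
  have key : spray L z = a ↔ lagrangianForce L z = vertHessian L z a := by
    rw [spray, ← he, ContinuousLinearMap.inverse_equiv]
    exact e.symm_apply_eq
  rw [key, ContinuousLinearMap.ext_iff]
  refine forall_congr' fun w => ?_
  have hsplit : ((z.2, a) : E × E) = (z.2, 0) + (0, a) := by simp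
  rw [lagrangianForce_apply, vertHessian_apply, hsplit, map_add, add_apply]
  constructor <;> intro h <;> linarith

end IsRegularLagrangian

/-! ### Maps preserving Lagrangians -/

namespace IsLagrangianMap

variable {U : Set E} {f g : E → E}

lemma contDiffAt (h : IsLagrangianMap Ω L Ω' L' U f) {x : E} (hx : x ∈ U) : ContDiffAt ℝ 2 f x :=
  h.contDiffOn.contDiffAt (h.isOpen.mem_nhds hx)

lemma contDiffAt_fderiv (h : IsLagrangianMap Ω L Ω' L' U f) {x : E} (hx : x ∈ U) :
    ContDiffAt ℝ 1 (fderiv ℝ f) x :=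
  (h.contDiffAt hx).fderiv_right (by norm_num)

lemma hasFDerivAt (h : IsLagrangianMap Ω L Ω' L' U f) {x : E} (hx : x ∈ U) :
    HasFDerivAt f (fderiv ℝ f x) x :=
  ((h.contDiffAt hx).differentiableAt (by norm_num)).hasFDerivAt

lemma hasFDerivAt_fderiv (h : IsLagrangianMap Ω L Ω' L' U f) {x : E} (hx : x ∈ U) :
    HasFDerivAt (fderiv ℝ f) (fderiv ℝ (fderiv ℝ f) x) x :=
  ((h.contDiffAt_fderiv hx).differentiableAt (by norm_num)).hasFDerivAt

/-- The derivative of the tangent map `(x, v) ↦ (f x, f'(x) v)`. -/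
lemma hasFDerivAt_tangent (h : IsLagrangianMap Ω L Ω' L' U f) {z : E × E} (hz : z.1 ∈ U) :
    ∃ T : E × E →L[ℝ] E × E,
      HasFDerivAt (fun y : E × E => (f y.1, fderiv ℝ f y.1 y.2)) T z ∧
      ∀ a b, T (a, b) =
        (fderiv ℝ f z.1 a, fderiv ℝ (fderiv ℝ f) z.1 a z.2 + fderiv ℝ f z.1 b) := by
  have h1 : HasFDerivAt (fun y : E × E => f y.1) _ z := (h.hasFDerivAt hz).comp z hasFDerivAt_fst
  have h2 : HasFDerivAt (fun y : E × E => fderiv ℝ f y.1) _ z :=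
    (h.hasFDerivAt_fderiv hz).comp z hasFDerivAt_fst
  refine ⟨_, h1.prodMk (h2.clm_apply hasFDerivAt_snd), fun a b => ?_⟩
  simp [add_comm]

/-- A map preserving the Lagrangians satisfies a second order equation that expresses
`f''(x)(v, v)` through the sprays and the first derivative of `f`. Only the combination of second
derivatives of the Lagrangian that enters the Euler–Lagrange equation is used, so that `f` need
only be `C^2`. -/
theorem fderiv_fderiv_apply_self [FiniteDimensional ℝ E] (h : IsLagrangianMap Ω L Ω' L' U f)
    (hL : IsRegularLagrangian Ω L) (hL' : IsRegularLagrangian Ω' L') {x v : E} (hx : x ∈ U)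
    (hv : (x, v) ∈ Ω) :
    fderiv ℝ (fderiv ℝ f) x v v =
      spray L' (f x, fderiv ℝ f x v) - fderiv ℝ f x (spray L (x, v)) := by
  set P : E × E → E × E := fun y => (f y.1, fderiv ℝ f y.1 y.2) with hP
  have hmem : ∀ z : E × E, z.1 ∈ U → z ∈ Ω → P z ∈ Ω' := fun z h1 h2 => h.mem z.1 h1 z.2 h2
  have hnhds : ∀ z : E × E, z.1 ∈ U → z ∈ Ω → ∀ᶠ y in 𝓝 z, y.1 ∈ U ∧ y ∈ Ω := fun z h1 h2 =>
    (continuous_fst.continuousAt.eventually (h.isOpen.mem_nhds h1)).and (hL.isOpen.mem_nhds h2)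
  -- First derivatives of the identity `L' ∘ P = L`.
  have first : ∀ z : E × E, z.1 ∈ U → z ∈ Ω → ∀ a b, fderiv ℝ L z (a, b) =
      fderiv ℝ L' (P z)
        (fderiv ℝ f z.1 a, fderiv ℝ (fderiv ℝ f) z.1 a z.2 + fderiv ℝ f z.1 b) := by
    intro z h1 h2 a b
    obtain ⟨T, hT, hTa⟩ := h.hasFDerivAt_tangent h1
    have hd : HasFDerivAt L' (fderiv ℝ L' (P z)) (P z) :=
      ((hL'.contDiffAt (hmem z h1 h2)).differentiableAt (by simp)).hasFDerivAt
    have hcomp : HasFDerivAt L ((fderiv ℝ L' (P z)).comp T) z := by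
      refine (hd.comp z hT).congr_of_eventuallyEq ?_
      filter_upwards [hnhds z h1 h2] with y hy
      exact (h.eq y.1 hy.1 y.2 hy.2).symm
    rw [hcomp.fderiv, ContinuousLinearMap.comp_apply, hTa]
  set z : E × E := (x, v) with hz
  obtain ⟨T, hT, hTa⟩ := h.hasFDerivAt_tangent (z := z) hx
  have hPz := hmem z hx hv
  set S := spray L z with hS
  have hEL := (hL.spray_eq_iff hv S).1 rfl
  symm
  rw [sub_eq_iff_eq_add, hL'.spray_eq_iff hPz]
  intro w'
  obtain ⟨w, rfl⟩ := h.surjective x hx w'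
  -- Derivative of the vertical part of the first order identity, in the direction `(v, S)`.
  have second : fderiv ℝ (fderiv ℝ L) z (v, S) (0, w) =
      fderiv ℝ (fderiv ℝ L') (P z) (T (v, S)) (0, fderiv ℝ f x w) +
        fderiv ℝ L' (P z) (0, fderiv ℝ (fderiv ℝ f) x v w) := by
    have hl : HasFDerivAt (fun y => fderiv ℝ L y (0, w)) _ z :=
      ((hL.contDiffAt_fderiv hv).differentiableAt (by simp)).hasFDerivAt.clm_apply
        (hasFDerivAt_const (0, w) z)
    have hD : HasFDerivAt (fun y => fderiv ℝ L' (P y)) _ z :=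
      ((hL'.contDiffAt_fderiv hPz).differentiableAt (by simp)).hasFDerivAt.comp z hT
    have hf2 : HasFDerivAt (fun y : E × E => fderiv ℝ f y.1) _ z :=
      (h.hasFDerivAt_fderiv (x := z.1) hx).comp z hasFDerivAt_fst
    have hr : HasFDerivAt (fun y => fderiv ℝ L' (P y) ((0 : E), fderiv ℝ f y.1 w)) _ z :=
      hD.clm_apply ((hasFDerivAt_const (0 : E) z).prodMk
        (hf2.clm_apply (hasFDerivAt_const w z)))
    have heq : (fun y => fderiv ℝ L y (0, w)) =ᶠ[𝓝 z]
        fun y => fderiv ℝ L' (P y) ((0 : E), fderiv ℝ f y.1 w) := by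
      filter_upwards [hnhds z hx hv] with y hy
      simp [first y hy.1 hy.2]
    have := congrArg (fun A => A (v, S)) (hl.unique (hr.congr_of_eventuallyEq heq))
    simpa [add_comm, hz] using this
  have hsymm : fderiv ℝ (fderiv ℝ f) x v w = fderiv ℝ (fderiv ℝ f) x w v :=
    (h.contDiffAt hx).isSymmSndFDerivAt (by simp) v w
  have hsum : ((fderiv ℝ f x w, fderiv ℝ (fderiv ℝ f) x w v) : E × E) =
      (fderiv ℝ f x w, 0) + (0, fderiv ℝ (fderiv ℝ f) x w v) := by simp
  have h1 := first z hx hv w 0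
  have h2 := hEL w
  simp only [hz, map_zero, add_zero] at h1
  rw [hsum, map_add] at h1
  simp only [hz] at h2 second hTa
  rw [hTa] at second
  rw [h1, second, hsymm] at h2
  simpa using h2

end IsLagrangianMap

end LocalTheory

/-! ### Smoothness and rigidity in the linear model -/

section LocalRigidity

variable {E : Type*} [NormedAddCommGroup E] [NormedSpace ℝ E]

lemma contDiffAt_of_forall_clm_apply {D F : Type*} [NormedAddCommGroup D] [NormedSpace ℝ D]
    [NormedAddCommGroup F] [NormedSpace ℝ F] [FiniteDimensional ℝ E] {n : ℕ∞}
    {f : D → E →L[ℝ] F} {x : D} (h : ∀ y, ContDiffAt ℝ n (fun z => f z y) x) :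
    ContDiffAt ℝ n f x := by
  let e₁ : E ≃L[ℝ] (Fin (Module.finrank ℝ E) → ℝ) :=
    ContinuousLinearEquiv.ofFinrankEq (Module.finrank_fin_fun ℝ).symm
  let e₂ := (e₁.arrowCongr (1 : F ≃L[ℝ] F)).trans
    (ContinuousLinearEquiv.piRing (Fin (Module.finrank ℝ E)))
  have h2 : ContDiffAt ℝ n (e₂ ∘ f) x := contDiffAt_pi.2 fun i => h _
  have h3 := e₂.symm.contDiff.contDiffAt.comp x h2
  rwa [← Function.comp_assoc, e₂.symm_comp_self, Function.id_comp] at h3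

/-- A bilinear map is recovered from its values on the diagonal at four points near any given
vector. -/
lemma bilin_apply_eq_of_diagonal {F : Type*} [NormedAddCommGroup F] [NormedSpace ℝ F]
    (B : E →L[ℝ] E →L[ℝ] F) (hB : ∀ u w, B u w = B w u) {ε : ℝ} (hε : ε ≠ 0) (v u w : E) :
    B u w = (2 * ε ^ 2)⁻¹ • (B (v + ε • (u + w)) (v + ε • (u + w)) - B (v + ε • u) (v + ε • u)
      - B (v + ε • w) (v + ε • w) + B v v) := by
  have h2 : (2 * ε ^ 2) ≠ 0 := by positivity
  rw [eq_inv_smul_iff₀ h2]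
  simp only [map_add, map_smul, add_apply, smul_apply, smul_add]
  rw [hB w u, hB u v, hB w v]
  module

variable {Ω Ω' : Set (E × E)} {L L' : E × E → ℝ}

/-- The second derivative of a map preserving the Lagrangians is a smooth function of its 1-jet:
the second derivative is known on the diagonal over an open set of vectors, hence everywhere by
polarization. -/
lemma exists_contDiffAt_fderiv_fderiv_eq [FiniteDimensional ℝ E] (hL : IsRegularLagrangian Ω L)
    (hL' : IsRegularLagrangian Ω' L') {x₀ y₀ v₀ : E} {A₀ : E →L[ℝ] E} (hv : (x₀, v₀) ∈ Ω)
    (hv' : (y₀, A₀ v₀) ∈ Ω') (u w : E) :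
    ∃ Ψ : E × E × (E →L[ℝ] E) → E, ContDiffAt ℝ ∞ Ψ (x₀, y₀, A₀) ∧
      ∀ᶠ x in 𝓝 x₀, ∀ U f, IsLagrangianMap Ω L Ω' L' U f → x ∈ U →
        fderiv ℝ (fderiv ℝ f) x u w = Ψ (x, f x, fderiv ℝ f x) := by
  have hgood : ∀ a : E, ∀ᶠ ε : ℝ in 𝓝 0, (x₀, v₀ + ε • a) ∈ Ω ∧ (y₀, A₀ (v₀ + ε • a)) ∈ Ω' := by
    intro a
    have c1 : Continuous fun ε : ℝ => (x₀, v₀ + ε • a) := by fun_prop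
    have c2 : Continuous fun ε : ℝ => (y₀, A₀ (v₀ + ε • a)) := by fun_prop
    exact (c1.continuousAt.eventually (hL.isOpen.mem_nhds (by simpa using hv))).and
      (c2.continuousAt.eventually (hL'.isOpen.mem_nhds (by simpa using hv')))
  -- One scale `ε` for which all the vectors used in the polarization are admissible.
  obtain ⟨ε, ⟨⟨huw, hu⟩, hw⟩, hε⟩ := ((((hgood (u + w)).and (hgood u)).and
    (hgood w)).filter_mono nhdsWithin_le_nhds |>.and self_mem_nhdsWithin :
      ∀ᶠ ε : ℝ in 𝓝[≠] 0, _ ∧ ε ∈ ({0}ᶜ : Set ℝ)).exists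
  let Q : E → E × E × (E →L[ℝ] E) → E := fun v q =>
    spray L' (q.2.1, q.2.2 v) - q.2.2 (spray L (q.1, v))
  have hQ : ∀ v, (x₀, v) ∈ Ω → (y₀, A₀ v) ∈ Ω' → ContDiffAt ℝ ∞ (Q v) (x₀, y₀, A₀) := by
    intro v h1 h2
    have hA : ContDiffAt ℝ ∞ (fun q : E × E × (E →L[ℝ] E) => q.2.2) (x₀, y₀, A₀) :=
      (contDiff_snd.comp contDiff_snd).contDiffAt
    have hy : ContDiffAt ℝ ∞ (fun q : E × E × (E →L[ℝ] E) => q.2.1) (x₀, y₀, A₀) :=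
      (contDiff_fst.comp contDiff_snd).contDiffAt
    refine ContDiffAt.sub ?_ (hA.clm_apply ?_)
    · exact ContDiffAt.comp (x₀, y₀, A₀) (hL'.contDiffAt_spray h2)
        (hy.prodMk (hA.clm_apply contDiffAt_const))
    · exact ContDiffAt.comp (x₀, y₀, A₀) (hL.contDiffAt_spray h1)
        (contDiffAt_fst.prodMk contDiffAt_const)
  have hnear : ∀ v, (x₀, v) ∈ Ω → ∀ᶠ x in 𝓝 x₀, (x, v) ∈ Ω := by
    intro v h
    have c : Continuous fun x : E => (x, v) := by fun_prop
    exact c.continuousAt.eventually (hL.isOpen.mem_nhds h)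
  refine ⟨fun q => (2 * ε ^ 2)⁻¹ • (Q (v₀ + ε • (u + w)) q - Q (v₀ + ε • u) q
      - Q (v₀ + ε • w) q + Q v₀ q), ?_, ?_⟩
  · exact contDiffAt_const.smul ((((hQ _ huw.1 huw.2).sub (hQ _ hu.1 hu.2)).sub
      (hQ _ hw.1 hw.2)).add (hQ _ hv hv'))
  · filter_upwards [hnear _ huw.1, hnear _ hu.1, hnear _ hw.1, hnear _ hv] with x h1 h2 h3 h4
    intro U f hf hx
    have hsymm := (hf.contDiffAt hx).isSymmSndFDerivAt (by simp)
    rw [bilin_apply_eq_of_diagonal _ (fun a b => hsymm a b) hε v₀ u w,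
      hf.fderiv_fderiv_apply_self hL hL' hx h1, hf.fderiv_fderiv_apply_self hL hL' hx h2,
      hf.fderiv_fderiv_apply_self hL hL' hx h3, hf.fderiv_fderiv_apply_self hL hL' hx h4]

/-- A map whose derivative is controlled by its own norm vanishes near each of its zeros: by
Grönwall's inequality on segments. -/
lemma eventually_eq_zero_of_norm_fderiv_le {F : Type*} [NormedAddCommGroup F] [NormedSpace ℝ F]
    {W : E → F} {x₀ : E} {K : ℝ}
    (h : ∀ᶠ x in 𝓝 x₀, ∃ W' : E →L[ℝ] F, HasFDerivAt W W' x ∧ ‖W'‖ ≤ K * ‖W x‖)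
    (h0 : W x₀ = 0) : ∀ᶠ x in 𝓝 x₀, W x = 0 := by
  obtain ⟨r, hr, hball⟩ := Metric.eventually_nhds_iff_ball.1 h
  choose! W' hW' hbd using hball
  filter_upwards [Metric.ball_mem_nhds x₀ hr] with x hx
  have hseg : ∀ t ∈ Icc (0 : ℝ) 1, x₀ + t • (x - x₀) ∈ Metric.ball x₀ r := by
    intro t ht
    rw [mem_ball_iff_norm] at hx ⊢
    rw [add_sub_cancel_left, norm_smul, Real.norm_of_nonneg ht.1]
    exact (mul_le_of_le_one_left (norm_nonneg _) ht.2).trans_lt hx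
  have hder : ∀ t ∈ Icc (0 : ℝ) 1, HasDerivAt (fun t : ℝ => W (x₀ + t • (x - x₀)))
      (W' (x₀ + t • (x - x₀)) (x - x₀)) t := by
    intro t ht
    have hline : HasDerivAt (fun t : ℝ => x₀ + t • (x - x₀)) (x - x₀) t := by
      simpa using ((hasDerivAt_id t).smul_const (x - x₀)).const_add x₀
    exact (hW' _ (hseg t ht)).comp_hasDerivAt t hline
  have := eq_zero_of_abs_deriv_le_mul_abs_self_of_eq_zero_right
    (f := fun t : ℝ => W (x₀ + t • (x - x₀))) (K := K * ‖x - x₀‖) (a := 0) (b := 1)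
    (fun t ht => (hder t ht).continuousAt.continuousWithinAt)
    (fun t ht => (hder t (Ico_subset_Icc_self ht)).hasDerivWithinAt) (by simpa using h0)
    (fun t ht => by
      refine (ContinuousLinearMap.le_opNorm _ _).trans ?_
      have := mul_le_mul_of_nonneg_right (hbd _ (hseg t (Ico_subset_Icc_self ht)))
        (norm_nonneg (x - x₀))
      linarith) 1 (by simp)
  simpa using this

namespace IsLagrangianMap

variable [FiniteDimensional ℝ E] {U V : Set E} {f g : E → E}

/-- A `C^2` map preserving regular Lagrangians is smooth: its second derivative is a smooth function
of its 1-jet, so each degree of differentiability yields the next one. -/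
theorem contDiffOn_infty (hf : IsLagrangianMap Ω L Ω' L' U f) (hL : IsRegularLagrangian Ω L)
    (hL' : IsRegularLagrangian Ω' L') (hΩ : ∀ x ∈ U, ∃ v, (x, v) ∈ Ω) : ContDiffOn ℝ ∞ f U := by
  have hdf : DifferentiableOn ℝ f U := hf.contDiffOn.differentiableOn (by norm_num)
  have hddf : DifferentiableOn ℝ (fderiv ℝ f) U := fun x hx =>
    (hf.hasFDerivAt_fderiv hx).differentiableAt.differentiableWithinAt
  have step : ∀ n : ℕ, ContDiffOn ℝ n f U ∧ ContDiffOn ℝ n (fderiv ℝ f) U := by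
    intro n
    induction n with
    | zero =>
      exact ⟨contDiffOn_zero.2 hdf.continuousOn, contDiffOn_zero.2 hddf.continuousOn⟩
    | succ n ih =>
      obtain ⟨ih1, ih2⟩ := ih
      push_cast
      refine ⟨(contDiffOn_succ_iff_fderiv_of_isOpen hf.isOpen).2 ⟨hdf, by simp, ih2⟩,
        (contDiffOn_succ_iff_fderiv_of_isOpen hf.isOpen).2 ⟨hddf, by simp, fun x hx => ?_⟩⟩
      have hxU := hf.isOpen.mem_nhds hx
      obtain ⟨v, hv⟩ := hΩ x hx
      refine ContDiffAt.contDiffWithinAt ?_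
      refine contDiffAt_of_forall_clm_apply (n := (n : ℕ∞)) fun u =>
        contDiffAt_of_forall_clm_apply (n := (n : ℕ∞)) fun w => ?_
      obtain ⟨Ψ, hΨ, hΨf⟩ :=
        exists_contDiffAt_fderiv_fderiv_eq hL hL' hv (hf.mem x hx v hv) u w
      have hjet : ContDiffAt ℝ n (fun y => (y, f y, fderiv ℝ f y)) x :=
        contDiffAt_id.prodMk ((ih1.contDiffAt hxU).prodMk (ih2.contDiffAt hxU))
      have hcomp : ContDiffAt ℝ n (fun y => Ψ (y, f y, fderiv ℝ f y)) x :=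
        ContDiffAt.comp x (hΨ.of_le (mod_cast le_top)) hjet
      refine hcomp.congr_of_eventuallyEq ?_
      filter_upwards [hΨf, hxU] with y hy hyU
      exact hy U f hf hyU
  exact _root_.contDiffOn_infty.2 fun n => (step n).1

/-- Two maps preserving the same Lagrangians and having the same 1-jet at a point agree near it. -/
theorem eventuallyEq_of_jet_eq (hf : IsLagrangianMap Ω L Ω' L' U f)
    (hg : IsLagrangianMap Ω L Ω' L' V g) (hL : IsRegularLagrangian Ω L)
    (hL' : IsRegularLagrangian Ω' L') {x₀ v₀ : E} (hxU : x₀ ∈ U) (hxV : x₀ ∈ V)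
    (hv : (x₀, v₀) ∈ Ω) (h0 : f x₀ = g x₀) (h1 : fderiv ℝ f x₀ = fderiv ℝ g x₀) :
    f =ᶠ[𝓝 x₀] g := by
  let W : E → E × (E →L[ℝ] E) := fun x => (f x - g x, fderiv ℝ f x - fderiv ℝ g x)
  have hcoord : ∀ u w : E, ∃ K : ℝ, 0 ≤ K ∧ ∀ᶠ x in 𝓝 x₀,
      ‖fderiv ℝ (fderiv ℝ f) x u w - fderiv ℝ (fderiv ℝ g) x u w‖ ≤ K * ‖W x‖ := by
    intro u w
    obtain ⟨Ψ, hΨ, hΨf⟩ :=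
      exists_contDiffAt_fderiv_fderiv_eq hL hL' hv (hf.mem x₀ hxU v₀ hv) u w
    obtain ⟨K, t, ht, hK⟩ := (hΨ.of_le (by simp)).exists_lipschitzOnWith
    have hjf : ∀ᶠ x in 𝓝 x₀, (x, f x, fderiv ℝ f x) ∈ t :=
      (continuousAt_id.prodMk ((hf.hasFDerivAt hxU).continuousAt.prodMk
        (hf.hasFDerivAt_fderiv hxU).continuousAt)).eventually ht
    have hjg : ∀ᶠ x in 𝓝 x₀, (x, g x, fderiv ℝ g x) ∈ t := by
      rw [h0, h1] at ht
      exact (continuousAt_id.prodMk ((hg.hasFDerivAt hxV).continuousAt.prodMk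
        (hg.hasFDerivAt_fderiv hxV).continuousAt)).eventually ht
    refine ⟨K, K.2, ?_⟩
    filter_upwards [hΨf, hjf, hjg, hf.isOpen.mem_nhds hxU, hg.isOpen.mem_nhds hxV]
      with x hx hxf hxg hU hV
    rw [hx U f hf hU, hx V g hg hV]
    refine (hK.norm_sub_le hxf hxg).trans_eq ?_
    simp [W, Prod.norm_def]
  choose K hK0 hK using hcoord
  -- The bounds on the entries in a basis combine into a bound on the norm of the second derivatives.
  let b := Module.finBasis ℝ E
  obtain ⟨C, hC, hCb⟩ := b.exists_opNorm_le (F := E)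
  obtain ⟨D, hD, hDb⟩ := b.exists_opNorm_le (F := E →L[ℝ] E)
  set M := ∑ i, ∑ j, K (b i) (b j) with hM
  have hM0 : 0 ≤ M := Finset.sum_nonneg fun i _ => Finset.sum_nonneg fun j _ => hK0 _ _
  have hle : ∀ i j, K (b i) (b j) ≤ M := fun i j =>
    (Finset.single_le_sum (f := fun j => K (b i) (b j)) (fun j _ => hK0 _ _)
      (Finset.mem_univ j)).trans
    (Finset.single_le_sum (f := fun i => ∑ j, K (b i) (b j))
      (fun i _ => Finset.sum_nonneg fun j _ => hK0 _ _) (Finset.mem_univ i))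
  have hall : ∀ᶠ x in 𝓝 x₀, ∀ i j, ‖fderiv ℝ (fderiv ℝ f) x (b i) (b j) -
      fderiv ℝ (fderiv ℝ g) x (b i) (b j)‖ ≤ K (b i) (b j) * ‖W x‖ :=
    eventually_all.2 fun i => eventually_all.2 fun j => hK (b i) (b j)
  have hW : ∀ᶠ x in 𝓝 x₀, W x = 0 := by
    refine eventually_eq_zero_of_norm_fderiv_le (K := max 1 (D * (C * M))) ?_
      (by simp [W, h0, h1])
    filter_upwards [hall, hf.isOpen.mem_nhds hxU, hg.isOpen.mem_nhds hxV] with x hx hU hV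
    refine ⟨_, ((hf.hasFDerivAt hU).sub (hg.hasFDerivAt hV)).prodMk
      ((hf.hasFDerivAt_fderiv hU).sub (hg.hasFDerivAt_fderiv hV)), ?_⟩
    have hsecond : ‖fderiv ℝ (fderiv ℝ f) x - fderiv ℝ (fderiv ℝ g) x‖ ≤
        D * (C * (M * ‖W x‖)) := by
      refine hDb (by positivity) fun i => hCb (by positivity) fun j => ?_
      exact (hx i j).trans (mul_le_mul_of_nonneg_right (hle i j) (norm_nonneg _))
    rw [ContinuousLinearMap.opNorm_prod, Prod.norm_def]
    refine max_le ?_ ?_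
    · exact (norm_snd_le (W x)).trans
        (le_mul_of_one_le_left (norm_nonneg _) (le_max_left _ _))
    · refine hsecond.trans ?_
      have := mul_le_mul_of_nonneg_right (le_max_right 1 (D * (C * M))) (norm_nonneg (W x))
      linarith
  filter_upwards [hW] with x hx
  exact sub_eq_zero.1 (congrArg Prod.fst hx)

end IsLagrangianMap

end LocalRigidity

/-! ### Passage to charts -/

section ChartRep

variable {H : Type*} [TopologicalSpace H] {M : Type*} [TopologicalSpace M] [ChartedSpace H M]

/-- The expression of `f` in the preferred charts at `p` and `q`. -/
noncomputable def chartRep (p q : M) (f : M → M) : H → H :=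
  chartAt H q ∘ f ∘ (chartAt H p).symm

/-- The domain of `chartRep p q f`. -/
def chartRepDomain (p q : M) (f : M → M) : Set H :=
  (chartAt H p).target ∩ (f ∘ (chartAt H p).symm) ⁻¹' (chartAt H q).source

lemma isOpen_chartRepDomain (p q : M) {f : M → M} (hf : Continuous f) :
    IsOpen (chartRepDomain (H := H) p q f) :=
  (hf.comp_continuousOn (chartAt H p).continuousOn_symm).isOpen_inter_preimage
    (chartAt H p).open_target (chartAt H q).open_source

lemma chartRep_mem_target {p q : M} {f : M → M} {x : H} (hx : x ∈ chartRepDomain p q f) :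
    chartRep p q f x ∈ (chartAt H q).target :=
  (chartAt H q).map_source hx.2

lemma symm_chartRep {p q : M} {f : M → M} {x : H} (hx : x ∈ chartRepDomain p q f) :
    (chartAt H q).symm (chartRep p q f x) = f ((chartAt H p).symm x) :=
  (chartAt H q).left_inv hx.2

lemma mem_chartRepDomain_self {p q : M} {f : M → M} (hq : f p ∈ (chartAt H q).source) :
    chartAt H p p ∈ chartRepDomain p q f := by
  refine ⟨mem_chart_target H p, ?_⟩
  simpa [(chartAt H p).left_inv (mem_chart_source H p)] using hq

end ChartRep

section Charts

variable {E : Type*} [NormedAddCommGroup E] [NormedSpace ℝ E]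
  {M : Type*} [TopologicalSpace M] [ChartedSpace E M]

/-- The inverse of the chart of `TM` induced by the preferred chart `φ` at `p`, namely
`(x, v) ↦ d(φ⁻¹)_x v`. -/
noncomputable def chartVector (p : M) (z : E × E) : TangentBundle 𝓘(ℝ, E) M :=
  tangentMap 𝓘(ℝ, E) 𝓘(ℝ, E) (chartAt E p).symm ⟨z.1, z.2⟩

lemma contMDiff_mk_modelSpace {n : WithTop ℕ∞} : ContMDiff 𝓘(ℝ, E × E) 𝓘(ℝ, E).tangent n
    (fun z : E × E => (⟨z.1, z.2⟩ : TangentBundle 𝓘(ℝ, E) E)) := by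
  have := contMDiff_tangentBundleModelSpaceHomeomorph_symm (n := n) (I := 𝓘(ℝ, E))
  rw [modelWithCornersSelf_prod]
  exact this

lemma contMDiffOn_chartVector [IsManifold 𝓘(ℝ, E) ∞ M] (p : M) :
    ContMDiffOn 𝓘(ℝ, E × E) 𝓘(ℝ, E).tangent ∞ (chartVector p : E × E → TangentBundle 𝓘(ℝ, E) M)
      ((chartAt E p).target ×ˢ univ) := by
  have hopen := (chartAt E p).open_target
  have h1 : ContMDiffOn 𝓘(ℝ, E) 𝓘(ℝ, E) ∞ (chartAt E p).symm (chartAt E p).target :=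
    contMDiffOn_chart_symm
  have h2 := h1.contMDiffOn_tangentMapWithin (m := ∞) (by simp) hopen.uniqueMDiffOn
  have heq : ∀ z ∈ (chartAt E p).target ×ˢ (univ : Set E),
      tangentMapWithin 𝓘(ℝ, E) 𝓘(ℝ, E) (chartAt E p).symm (chartAt E p).target
        (⟨z.1, z.2⟩ : TangentBundle 𝓘(ℝ, E) E) = chartVector p z := fun z hz =>
    tangentMapWithin_eq_tangentMap (hopen.uniqueMDiffOn z.1 hz.1)
      ((h1.mdifferentiableOn (by simp)).mdifferentiableAt (hopen.mem_nhds hz.1))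
  have hmaps : MapsTo (fun z : E × E => (⟨z.1, z.2⟩ : TangentBundle 𝓘(ℝ, E) E))
      ((chartAt E p).target ×ˢ univ) (Bundle.TotalSpace.proj ⁻¹' (chartAt E p).target) :=
    fun z hz => hz.1
  have h3 := ContMDiffOn.comp h2 (contMDiff_mk_modelSpace (n := ∞)).contMDiffOn hmaps
  exact h3.congr fun z hz => (heq z hz).symm

lemma contDiffOn_chartRep [IsManifold 𝓘(ℝ, E) ∞ M] (p q : M) {f : M → M}
    (hf : ContMDiff 𝓘(ℝ, E) 𝓘(ℝ, E) 2 f) :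
    ContDiffOn ℝ 2 (chartRep (H := E) p q f) (chartRepDomain p q f) := by
  have : IsManifold 𝓘(ℝ, E) 2 M := IsManifold.of_le (n := ∞) ENat.LEInfty.out
  rw [← contMDiffOn_iff_contDiffOn]
  have h1 : ContMDiffOn 𝓘(ℝ, E) 𝓘(ℝ, E) 2 (chartAt E p).symm (chartAt E p).target :=
    contMDiffOn_chart_symm
  have h2 : ContMDiffOn 𝓘(ℝ, E) 𝓘(ℝ, E) 2 (chartAt E q) (chartAt E q).source :=
    contMDiffOn_chart
  exact h2.comp (hf.comp_contMDiffOn (h1.mono inter_subset_left)) fun x hx => hx.2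

/-- In charts, the tangent map of `f` is `(x, v) ↦ (f x, f'(x) v)`. -/
lemma chartVector_chartRep [IsManifold 𝓘(ℝ, E) ∞ M] {p q : M} {f : M → M}
    (hf : ContMDiff 𝓘(ℝ, E) 𝓘(ℝ, E) 2 f) {x : E} (hx : x ∈ chartRepDomain p q f) (v : E) :
    chartVector q (chartRep p q f x, fderiv ℝ (chartRep p q f) x v) =
      tangentMap 𝓘(ℝ, E) 𝓘(ℝ, E) f (chartVector p (x, v)) := by
  have hU := isOpen_chartRepDomain (H := E) p q hf.continuous
  have : IsManifold 𝓘(ℝ, E) 1 M := IsManifold.of_le (n := ∞) ENat.LEInfty.out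
  have hp : MDifferentiableAt 𝓘(ℝ, E) 𝓘(ℝ, E) (chartAt E p).symm x :=
    mdifferentiableAt_atlas_symm (chart_mem_atlas E p) hx.1
  have hq : MDifferentiableAt 𝓘(ℝ, E) 𝓘(ℝ, E) (chartAt E q).symm (chartRep p q f x) :=
    mdifferentiableAt_atlas_symm (chart_mem_atlas E q) (chartRep_mem_target hx)
  have hr : MDifferentiableAt 𝓘(ℝ, E) 𝓘(ℝ, E) (chartRep (H := E) p q f) x :=
    (((contDiffOn_chartRep p q hf).contDiffAt (hU.mem_nhds hx)).differentiableAt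
      (by norm_num)).mdifferentiableAt
  have hfm : MDifferentiableAt 𝓘(ℝ, E) 𝓘(ℝ, E) f ((chartAt E p).symm x) :=
    (hf.mdifferentiable (by norm_num)) _
  let X : TangentBundle 𝓘(ℝ, E) E := ⟨x, v⟩
  have e1 := tangentMap_comp_at (I := 𝓘(ℝ, E)) (I' := 𝓘(ℝ, E)) (I'' := 𝓘(ℝ, E))
    (f := chartRep p q f) (g := (chartAt E q).symm) X hq hr
  have e2 := tangentMap_comp_at (I := 𝓘(ℝ, E)) (I' := 𝓘(ℝ, E)) (I'' := 𝓘(ℝ, E))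
    (f := (chartAt E p).symm) (g := f) X hfm hp
  have huniq := hU.uniqueMDiffOn (I := 𝓘(ℝ, E)) x hx
  have e3 : tangentMap 𝓘(ℝ, E) 𝓘(ℝ, E) ((chartAt E q).symm ∘ chartRep p q f) X =
      tangentMap 𝓘(ℝ, E) 𝓘(ℝ, E) (f ∘ (chartAt E p).symm) X := by
    rw [← tangentMapWithin_eq_tangentMap huniq (hq.comp x hr),
      ← tangentMapWithin_eq_tangentMap huniq (hfm.comp x hp)]
    exact tangentMapWithin_congr (fun y hy => symm_chartRep hy) X hx
  rw [e1, e2] at e3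
  rw [chartVector, chartVector, ← e3]
  simp only [tangentMap, X, mfderiv_eq_fderiv]
  rfl

/-- The restriction of a `C^2` function to a vertical line has second derivative given by the
vertical part of the Hessian. -/
lemma fderiv_fderiv_comp_vertical {L : E × E → ℝ} {x v : E} (T : E →L[ℝ] E)
    (hL : ContDiffAt ℝ 2 L (x, T v)) (u w : E) :
    fderiv ℝ (fderiv ℝ fun y => L (x, T y)) v u w =
      fderiv ℝ (fderiv ℝ L) (x, T v) (0, T u) (0, T w) := by
  have hin : ∀ y, HasFDerivAt (fun y => (x, T y)) ((0 : E →L[ℝ] E).prod T) y := fun y =>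
    (hasFDerivAt_const x y).prodMk T.hasFDerivAt
  have hnear : ∀ᶠ y in 𝓝 v, ContDiffAt ℝ 2 L (x, T y) :=
    (hin v).continuousAt.eventually (hL.eventually (by simp))
  have heq : (fderiv ℝ fun y => L (x, T y)) =ᶠ[𝓝 v]
      fun y => (fderiv ℝ L (x, T y)).comp ((0 : E →L[ℝ] E).prod T) := by
    filter_upwards [hnear] with y hy
    exact ((hy.differentiableAt (by norm_num)).hasFDerivAt.comp y (hin y)).fderiv
  have hD : HasFDerivAt (fun y => fderiv ℝ L (x, T y)) _ v :=
    (((hL.fderiv_right (m := 1) (by norm_num)).differentiableAt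
      (by norm_num)).hasFDerivAt).comp v (hin v)
  rw [heq.fderiv_eq, (hD.clm_comp (hasFDerivAt_const ((0 : E →L[ℝ] E).prod T) v)).fderiv]
  simp

end Charts

/-! ### Isometries of pseudo-Finsler structures -/

namespace PseudoFinslerStructure

variable {E : Type*} [NormedAddCommGroup E] [NormedSpace ℝ E]
  {M : Type*} [TopologicalSpace M] [ChartedSpace E M] [IsManifold 𝓘(ℝ, E) ∞ M]
  (Φ : PseudoFinslerStructure E M)

/-- The admissible vectors over the domain of the preferred chart at `p`, in coordinates. -/
def chartDomain (p : M) : Set (E × E) :=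
  ((chartAt E p).target ×ˢ univ) ∩ chartVector p ⁻¹' Φ.cone

/-- The Lagrangian `F ^ 2` in the coordinates given by the preferred chart at `p`. -/
noncomputable def chartLagrangian (p : M) (z : E × E) : ℝ :=
  Φ.F (chartVector p z) ^ 2

lemma isRegularLagrangian (p : M) :
    IsRegularLagrangian (Φ.chartDomain p) (Φ.chartLagrangian p) := by
  have hopen : IsOpen (Φ.chartDomain p) :=
    (contMDiffOn_chartVector p).continuousOn.isOpen_inter_preimage
      ((chartAt E p).open_target.prod isOpen_univ) Φ.isOpen_cone
  have hsmooth : ContDiffOn ℝ ∞ (Φ.chartLagrangian p) (Φ.chartDomain p) := by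
    have hF : ContMDiffOn 𝓘(ℝ, E × E) 𝓘(ℝ, ℝ) ∞ (fun z => Φ.F (chartVector p z))
        (Φ.chartDomain p) :=
      Φ.contMDiffOn_F.comp ((contMDiffOn_chartVector p).mono inter_subset_left) fun z hz => hz.2
    exact (contMDiffOn_iff_contDiffOn.1 hF).pow 2
  refine ⟨hopen, hsmooth, ?_⟩
  rintro ⟨x, v⟩ hz u hu
  have hx : x ∈ (chartAt E p).target := hz.1.1
  have : IsManifold 𝓘(ℝ, E) 1 M := IsManifold.of_le (n := ∞) ENat.LEInfty.out
  -- The chart at `p` identifies the fibre over `φ⁻¹ x` with `E` differently than the preferred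
  -- chart of that point does; `e` is the change of identification.
  let e : E ≃L[ℝ] E := (mdifferentiable_chart (I := 𝓘(ℝ, E)) p).symm.mfderiv hx
  have he : ∀ y, chartVector p (x, y) =
      (⟨(chartAt E p).symm x, e y⟩ : TangentBundle 𝓘(ℝ, E) M) := fun y => rfl
  have hcone : (⟨(chartAt E p).symm x, e v⟩ : TangentBundle 𝓘(ℝ, E) M) ∈ Φ.cone := by
    rw [← he]; exact hz.2
  have hfun : (fun y : E => Φ.F (⟨(chartAt E p).symm x, y⟩ : TangentBundle 𝓘(ℝ, E) M) ^ 2) =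
      fun y => Φ.chartLagrangian p (x, (e.symm : E →L[ℝ] E) y) := by
    funext y
    rw [chartLagrangian, he]
    simp
  have h0 := Φ.nondegenerate _ (e v) hcone (e u) fun w => by
    rw [hfun, fderiv_fderiv_comp_vertical]
    · simpa using hu (e.symm w)
    · simp only [ContinuousLinearEquiv.coe_coe, ContinuousLinearEquiv.symm_apply_apply]
      exact (hsmooth.contDiffAt (hopen.mem_nhds hz)).of_le ENat.LEInfty.out
  simpa using h0

lemma exists_mem_chartDomain {p : M} {x : E} (hx : x ∈ (chartAt E p).target) :
    ∃ v, (x, v) ∈ Φ.chartDomain p := by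
  have : IsManifold 𝓘(ℝ, E) 1 M := IsManifold.of_le (n := ∞) ENat.LEInfty.out
  let e : E ≃L[ℝ] E := (mdifferentiable_chart (I := 𝓘(ℝ, E)) p).symm.mfderiv hx
  have he : ∀ y, chartVector p (x, y) =
      (⟨(chartAt E p).symm x, e y⟩ : TangentBundle 𝓘(ℝ, E) M) := fun y => rfl
  obtain ⟨v, hv⟩ := Φ.nonempty_fiber ((chartAt E p).symm x)
  refine ⟨e.symm (v : E), ⟨hx, mem_univ _⟩, ?_⟩
  have hev : e (e.symm (v : E)) = v := e.apply_symm_apply _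
  rw [mem_preimage, he, hev]
  exact hv

variable {Φ} {f g : Diffeomorph 𝓘(ℝ, E) 𝓘(ℝ, E) M M 2}

/-- In charts, the derivative of a diffeomorphism is onto, by the chain rule for its inverse. -/
lemma _root_.Diffeomorph.surjective_fderiv_chartRep (f : Diffeomorph 𝓘(ℝ, E) 𝓘(ℝ, E) M M 2)
    {p q : M} {x : E} (hx : x ∈ chartRepDomain p q f) :
    Function.Surjective (fderiv ℝ (chartRep p q f) x) := by
  set y := chartRep p q f x with hy
  have hinv : f.symm ((chartAt E q).symm y) = (chartAt E p).symm x := by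
    rw [hy, symm_chartRep hx, f.symm_apply_apply]
  have hyV : y ∈ chartRepDomain q p f.symm := by
    refine ⟨chartRep_mem_target hx, ?_⟩
    rw [mem_preimage, Function.comp_apply, hinv]
    exact (chartAt E p).map_target hx.1
  have hyx : chartRep q p f.symm y = x := by
    rw [chartRep, Function.comp_apply, Function.comp_apply, hinv, (chartAt E p).right_inv hx.1]
  have hU := isOpen_chartRepDomain (H := E) p q f.continuous
  have hV := isOpen_chartRepDomain (H := E) q p f.symm.continuous
  have hdf : DifferentiableAt ℝ (chartRep p q f) (chartRep q p f.symm y) := by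
    rw [hyx]
    exact ((contDiffOn_chartRep p q f.contMDiff).contDiffAt (hU.mem_nhds hx)).differentiableAt
      (by norm_num)
  have hdg : DifferentiableAt ℝ (chartRep q p f.symm) y :=
    ((contDiffOn_chartRep q p f.symm.contMDiff).contDiffAt (hV.mem_nhds hyV)).differentiableAt
      (by norm_num)
  have hid : chartRep p q f ∘ chartRep q p f.symm =ᶠ[𝓝 y] id := by
    filter_upwards [hV.mem_nhds hyV] with z hz
    have : (chartAt E p).symm (chartRep q p f.symm z) = f.symm ((chartAt E q).symm z) :=
      symm_chartRep hz
    rw [Function.comp_apply, chartRep, Function.comp_apply, Function.comp_apply, this,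
      f.apply_symm_apply, (chartAt E q).right_inv hz.1, id]
  have hchain := fderiv_comp y hdf hdg
  rw [hid.fderiv_eq, fderiv_id, hyx] at hchain
  intro w
  exact ⟨fderiv ℝ (chartRep q p f.symm) y w, (congrArg (fun A => A w) hchain).symm⟩

lemma IsIsometry.isLagrangianMap (hf : Φ.IsIsometry f) (p q : M) :
    IsLagrangianMap (Φ.chartDomain p) (Φ.chartLagrangian p) (Φ.chartDomain q)
      (Φ.chartLagrangian q) (chartRepDomain p q f) (chartRep p q f) where
  isOpen := isOpen_chartRepDomain p q f.continuous
  contDiffOn := contDiffOn_chartRep p q f.contMDiff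
  surjective x hx := f.surjective_fderiv_chartRep hx
  mem x hx v hv := by
    refine ⟨⟨chartRep_mem_target hx, mem_univ _⟩, ?_⟩
    rw [mem_preimage, chartVector_chartRep f.contMDiff hx, ← hf.image_cone]
    exact mem_image_of_mem _ hv.2
  eq x hx v hv := by
    rw [chartLagrangian, chartVector_chartRep f.contMDiff hx, hf.F_tangentMap _ hv.2,
      chartLagrangian]

variable [FiniteDimensional ℝ E]

theorem IsIsometry.contMDiff (hf : Φ.IsIsometry f) : ContMDiff 𝓘(ℝ, E) 𝓘(ℝ, E) ∞ f := by
  intro p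
  have hmem : chartAt E p p ∈ chartRepDomain p (f p) f :=
    mem_chartRepDomain_self (mem_chart_source E (f p))
  have hloc := hf.isLagrangianMap p (f p)
  have hsmooth := hloc.contDiffOn_infty (Φ.isRegularLagrangian p)
    (Φ.isRegularLagrangian (f p)) fun x hx => Φ.exists_mem_chartDomain hx.1
  rw [contMDiffAt_iff]
  refine ⟨f.continuous.continuousAt, ?_⟩
  have := hsmooth.contDiffAt (hloc.isOpen.mem_nhds hmem)
  simpa [chartRep, contDiffWithinAt_univ] using this

/-- Two isometries with the same 1-jet at `p`, expressed in the charts at `p` and at a point `q`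
whose chart contains the common image, agree near `p`. -/
theorem IsIsometry.eventuallyEq (hf : Φ.IsIsometry f) (hg : Φ.IsIsometry g) {p q : M}
    (hq : f p ∈ (chartAt E q).source) (h0 : f p = g p)
    (h1 : fderiv ℝ (chartRep p q f) (chartAt E p p) =
      fderiv ℝ (chartRep p q g) (chartAt E p p)) : f =ᶠ[𝓝 p] g := by
  have hmf : chartAt E p p ∈ chartRepDomain p q f := mem_chartRepDomain_self hq
  have hmg : chartAt E p p ∈ chartRepDomain p q g := mem_chartRepDomain_self (h0 ▸ hq)
  obtain ⟨v, hv⟩ := Φ.exists_mem_chartDomain (mem_chart_target E p)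
  have hval : chartRep p q f (chartAt E p p) = chartRep p q g (chartAt E p p) := by
    simp [chartRep, h0]
  have hLf := hf.isLagrangianMap p q
  have hLg := hg.isLagrangianMap p q
  have heq := hLf.eventuallyEq_of_jet_eq hLg (Φ.isRegularLagrangian p)
    (Φ.isRegularLagrangian q) hmf hmg hv hval h1
  have hc : ContinuousAt (chartAt E p) p := (chartAt E p).continuousAt (mem_chart_source E p)
  filter_upwards [hc.eventually heq, hc.eventually (hLf.isOpen.mem_nhds hmf),
    hc.eventually (hLg.isOpen.mem_nhds hmg), (chartAt E p).open_source.mem_nhds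
      (mem_chart_source E p)] with y hy hyf hyg hyp
  have hs := (chartAt E p).left_inv hyp
  have h2 := congrArg (chartAt E q).symm hy
  have e1 := symm_chartRep hyf
  have e2 := symm_chartRep hyg
  rw [hs] at e1 e2
  rwa [e1, e2] at h2

/-- Two isometries that agree near some point agree everywhere: the set of such points is open, and
it is closed because at a limit point the 1-jets agree by continuity. -/
theorem IsIsometry.eq_of_eventuallyEq [T2Space M] [PreconnectedSpace M] (hf : Φ.IsIsometry f)
    (hg : Φ.IsIsometry g) {p : M} (h : f =ᶠ[𝓝 p] g) : f = g := by
  let A : Set M := {x | f =ᶠ[𝓝 x] g}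
  have hopen : IsOpen A := isOpen_setOfPred_eventually_nhds
  have hclosed : IsClosed A := by
    rw [← closure_subset_iff_isClosed]
    intro x hx
    have hx0 : f x = g x := by
      refine closure_minimal (fun y hy => ?_) (isClosed_eq f.continuous g.continuous) hx
      exact Filter.Eventually.self_of_nhds hy
    have hq := mem_chart_source E (f x)
    refine hf.eventuallyEq hg hq hx0 ?_
    set φ := chartAt E x with hφ
    have hmf : φ x ∈ chartRepDomain x (f x) f := mem_chartRepDomain_self hq
    have hmg : φ x ∈ chartRepDomain x (f x) g := mem_chartRepDomain_self (hx0 ▸ hq)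
    have hc : ContinuousAt φ x := φ.continuousAt (mem_chart_source E x)
    have hcf : ContinuousAt (fun y => fderiv ℝ (chartRep x (f x) f) (φ y)) x :=
      ContinuousAt.comp (f := φ)
        ((hf.isLagrangianMap x (f x)).hasFDerivAt_fderiv hmf).continuousAt hc
    have hcg : ContinuousAt (fun y => fderiv ℝ (chartRep x (f x) g) (φ y)) x :=
      ContinuousAt.comp (f := φ)
        ((hg.isLagrangianMap x (f x)).hasFDerivAt_fderiv hmg).continuousAt hc
    have : (𝓝[A] x).NeBot := mem_closure_iff_nhdsWithin_neBot.1 hx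
    refine tendsto_nhds_unique_of_eventuallyEq (l := 𝓝[A] x) (hcf.mono_left nhdsWithin_le_nhds)
      (hcg.mono_left nhdsWithin_le_nhds) ?_
    filter_upwards [self_mem_nhdsWithin, nhdsWithin_le_nhds
      (φ.open_source.mem_nhds (mem_chart_source E x))] with y hyA hyφ
    refine Filter.EventuallyEq.fderiv_eq ?_
    have hsymm : ContinuousAt φ.symm (φ y) := φ.continuousAt_symm (φ.map_source hyφ)
    have hyA' : ∀ᶠ z in 𝓝 (φ.symm (φ y)), f z = g z := by
      rw [φ.left_inv hyφ]; exact hyA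
    filter_upwards [hsymm.eventually hyA'] with z hz
    simp only [chartRep, Function.comp_apply]
    rw [hz]
  have huniv : A = univ := IsClopen.eq_univ ⟨hclosed, hopen⟩ ⟨p, h⟩
  ext x
  have hx : x ∈ A := by rw [huniv]; exact mem_univ x
  exact (show f =ᶠ[𝓝 x] g from hx).eq_of_nhds

end PseudoFinslerStructure

theorem mainTheorem2
    {E : Type*} [NormedAddCommGroup E] [NormedSpace ℝ E] [FiniteDimensional ℝ E]
    {M : Type*} [TopologicalSpace M] [T2Space M] [ConnectedSpace M]
    [ChartedSpace E M] [IsManifold 𝓘(ℝ, E) ∞ M]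
    (Φ : PseudoFinslerStructure E M) :
    (∀ f : Diffeomorph 𝓘(ℝ, E) 𝓘(ℝ, E) M M 2, Φ.IsIsometry f →
      ContMDiff 𝓘(ℝ, E) 𝓘(ℝ, E) ∞ f) ∧
    (∀ f g : Diffeomorph 𝓘(ℝ, E) 𝓘(ℝ, E) M M 2, Φ.IsIsometry f → Φ.IsIsometry g →
      ∀ p : M, SameJetAt E 2 f g p → f = g) := by
  refine ⟨fun f hf => hf.contMDiff, fun f g hf hg p hjet => ?_⟩
  refine hf.eq_of_eventuallyEq hg (p := p) ?_
  refine hf.eventuallyEq hg (mem_chart_source E (f p)) hjet.1 ?_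
  ext v
  have h1 := congrArg (fun A => A fun _ => v) (hjet.2 1 (by norm_num))
  simp only [iteratedFDeriv_one_apply] at h1
  simpa [chartRep] using h1
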